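/- Let $g\ge 0$ be an integer and identify quadratic forms on $\mathbb{R}^g$ with real symmetric $g\times g$ matrices, $Q(x)=x^tQx$. Let $\Omega_g$ be the cone of positive definite forms and $\Omega_g^{\mathrm{rt}}$ the cone of positive semi-definite forms whose null space has a basis in $\mathbb{Q}^g$. For $Q\in\Omega_g$ let $M(Q)$ be the set of vectors $\xi\in\mathbb{Z}^g\setminus\{0\}$ with $Q(\xi)=\min_{\eta\in\mathbb{Z}^g\setminus\{0\}}Q(\eta)$ (so $M(Q)=\emptyset$ if $g=0$), let $\sigma[Q]=\mathbb{R}_{\ge 0}\langle \xi\xi^t : \xi\in M(Q)\rangle$, and let $\Sigma_P=\{\sigma[Q] : Q\in\Omega_g\}$ (the perfect cone decomposition). For $Q\in\Omega_g^{\mathrm{rt}}$ let $\mathrm{Del}(Q)$ be the Delone subdivision of $\mathbb{R}^g$ whose cells are the projections to $\mathbb{R}^g$ of the lower faces of the convex hull of $\{(x,Q(x)) : x\in\mathbb{Z}^g\}\subset\mathbb{R}^g\times\mathbb{R}$. For a Delone subdivision $D$ (that is, $D=\mathrm{Del}(Q_0)$ for some $Q_0\in\Omega_g^{\mathrm{rt}}$)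 let $\sigma_D$ be the closure of $\{Q\in\Omega_g^{\mathrm{rt}} : \mathrm{Del}(Q)=D\}$ in the space of quadratic forms, and let $\Sigma_V=\{\sigma_D : D \text{ a Delone subdivision}\}$ (the second Voronoi decomposition). Call an integer $g\times n$ matrix $A$ ($n\ge 0$) unimodular if $hA$ is totally unimodular (every square submatrix has determinant $0$, $1$ or $-1$) for some $h\in\mathrm{GL}_g(\mathbb{Z})$, and simple if it has no zero column and no two proportional columns. For such a simple unimodular matrix $A$ with columns $v_1,\dots,v_n$ let $\sigma(A)=\mathbb{R}_{\ge 0}\langle v_1v_1^t,\dots,v_nv_n^t\rangle$, and let $\Sigma_{\mathrm{mat}}$ be the set of all these cones $\sigma(A)$, over all $n$ (the matroidal decomposition). Then $$\Sigma_V\cap\Sigma_P\subseteq\Sigma_{\mathrm{mat}},$$ i.e. if $\sigma$ is a cone of $\Sigma_V$ and of $\Sigma_P$, then $\sigma$ is a cone of $\Sigma_{\mathrm{mat}}$. -/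

import Mathlib

open scoped Matrix

namespace QuadCone

/-- An integer vector, regarded as a vector of `ℝ^g`. -/
def toReal {g : ℕ} (x : Fin g → ℤ) : Fin g → ℝ := fun i => (x i : ℝ)

/-- The value `Q(x) = xᵗ Q x` of the quadratic form with symmetric matrix `Q`. -/
def value {g : ℕ} (Q : Matrix (Fin g) (Fin g) ℝ) (x : Fin g → ℝ) : ℝ := x ⬝ᵥ (Q *ᵥ x)

/-- The rank one quadratic form `ξ ξᵗ` of an integer vector. -/
def rankOne {g : ℕ} (ξ : Fin g → ℤ) : Matrix (Fin g) (Fin g) ℝ :=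
  Matrix.vecMulVec (toReal ξ) (toReal ξ)

/-- The cone of positive definite quadratic forms on `ℝ^g`. -/
def posDefForms (g : ℕ) : Set (Matrix (Fin g) (Fin g) ℝ) := {Q | Q.PosDef}

/-- The cone of rational positive semi-definite quadratic forms on `ℝ^g`: those whose null space
(which is the kernel of the matrix, the form being positive semi-definite) is spanned over `ℝ` by
vectors of `ℚ^g`. -/
def rationalForms (g : ℕ) : Set (Matrix (Fin g) (Fin g) ℝ) :=
  {Q | Q.PosSemidef ∧ ∃ S : Set (Fin g → ℚ),
    Submodule.span ℝ ((fun (v : Fin g → ℚ) (i : Fin g) => (v i : ℝ)) '' S) =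
      LinearMap.ker Q.mulVecLin}

/-! ### The perfect cone decomposition -/

/-- The set `M(Q)` of integer vectors at which `Q` takes its minimum over the nonzero integer
vectors. -/
def minimalVectors {g : ℕ} (Q : Matrix (Fin g) (Fin g) ℝ) : Set (Fin g → ℤ) :=
  {ξ | IsLeast ((fun η : Fin g → ℤ => value Q (toReal η)) '' {η | η ≠ 0}) (value Q (toReal ξ))}

/-- The cone `σ[Q]` generated by the forms `ξ ξᵗ` with `ξ ∈ M(Q)`. -/
def perfectCone {g : ℕ} (Q : Matrix (Fin g) (Fin g) ℝ) : Set (Matrix (Fin g) (Fin g) ℝ) :=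
  (PointedCone.hull ℝ (rankOne '' minimalVectors Q) : Set (Matrix (Fin g) (Fin g) ℝ))

/-- The perfect cone decomposition `Σ_P`. -/
def perfectConeDecomposition (g : ℕ) : Set (Set (Matrix (Fin g) (Fin g) ℝ)) :=
  perfectCone '' posDefForms g

/-! ### The second Voronoi decomposition -/

/-- The convex hull in `ℝ^g × ℝ` of the points `(x, Q(x))`, for `x ∈ ℤ^g`. -/
def liftedHull {g : ℕ} (Q : Matrix (Fin g) (Fin g) ℝ) : Set ((Fin g → ℝ) × ℝ) :=
  convexHull ℝ (Set.range fun x : Fin g → ℤ => (toReal x, value Q (toReal x)))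

/-- `F` is a (nonempty) lower face of `C ⊆ ℝ^g × ℝ`: the set of points of `C` where some linear
functional whose last coefficient is positive (normalized to `1`) attains its minimum over `C`. -/
def IsLowerFace {g : ℕ} (C F : Set ((Fin g → ℝ) × ℝ)) : Prop :=
  F.Nonempty ∧ ∃ c : Fin g → ℝ,
    F = {p ∈ C | ∀ q ∈ C, c ⬝ᵥ p.1 + p.2 ≤ c ⬝ᵥ q.1 + q.2}

/-- The Delone subdivision `Del(Q)`, as the collection of all its cells: the projections to `ℝ^g`
of the lower faces of the convex hull of the points `(x, Q(x))`. -/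
def delone {g : ℕ} (Q : Matrix (Fin g) (Fin g) ℝ) : Set (Set (Fin g → ℝ)) :=
  {P | ∃ F, IsLowerFace (liftedHull Q) F ∧ P = Prod.fst '' F}

/-- The secondary cone `σ_D` of a collection of cells `D`: the closure of the set of rational
positive semi-definite forms whose Delone subdivision is `D`. -/
def secondaryCone {g : ℕ} (D : Set (Set (Fin g → ℝ))) : Set (Matrix (Fin g) (Fin g) ℝ) :=
  closure {Q ∈ rationalForms g | delone Q = D}

/-- The second Voronoi decomposition `Σ_V`: the secondary cones of all Delone subdivisions of
rational positive semi-definite forms. -/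
def secondVoronoiDecomposition (g : ℕ) : Set (Set (Matrix (Fin g) (Fin g) ℝ)) :=
  {σ | ∃ D ∈ delone '' rationalForms g, σ = secondaryCone D}

/-! ### The matroidal decomposition -/

/-- `A` is unimodular: `h A` is totally unimodular for some `h ∈ GL_g(ℤ)`. -/
def IsUnimodular {g n : ℕ} (A : Matrix (Fin g) (Fin n) ℤ) : Prop :=
  ∃ h : GL (Fin g) ℤ, ((h : Matrix (Fin g) (Fin g) ℤ) * A).IsTotallyUnimodular

/-- `A` is simple: it has no zero column and no pair of proportional columns. -/
def IsSimple {g n : ℕ} (A : Matrix (Fin g) (Fin n) ℤ) : Prop :=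
  (∀ j, A.col j ≠ 0) ∧
    ∀ i j, i ≠ j → ∀ c : ℝ, toReal (A.col i) ≠ c • toReal (A.col j)

/-- The cone `σ(A)` generated by the forms `v vᵗ`, for `v` a column of `A`. -/
def matroidalCone {g n : ℕ} (A : Matrix (Fin g) (Fin n) ℤ) : Set (Matrix (Fin g) (Fin g) ℝ) :=
  (PointedCone.hull ℝ (Set.range fun j => rankOne (A.col j)) : Set (Matrix (Fin g) (Fin g) ℝ))

/-- The matroidal decomposition `Σ_mat`: all cones `σ(A)`, for `A` a simple unimodular matrix with
`g` rows and any number of columns. -/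
def matroidalDecomposition (g : ℕ) : Set (Set (Matrix (Fin g) (Fin g) ℝ)) :=
  {σ | ∃ (n : ℕ) (A : Matrix (Fin g) (Fin n) ℤ),
    IsUnimodular A ∧ IsSimple A ∧ σ = matroidalCone A}

end QuadCone

/-! Let σ be both a perfect cone and the secondary cone of `D = Del(Q₀)`. Choosing one of each pair
±ξ of minimal vectors gives a simple matrix `A` with primitive columns and σ = σ(A); only
unimodularity is at stake.

Each ξξᵗ lies in the secondary cone. Passing to the limit in the inequalities that define Delone
cells shows that ξ takes values differing by at most 1 on the lattice points of any cell of `D`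
(`dotProduct_sub_dotProduct_le_one`). Given linearly independent columns ξ_i and integers m_i, take
a real y with ξ_i ⬝ y = m_i. Modulo the null space of `Q₀`, on which every column vanishes, y is a
convex combination of lattice points of one cell (`exists_mem_convexHull_argminLattice`). The values
of ξ_i there differ by at most 1 and average to the integer m_i, so every lattice point of positive
weight solves the system (`exists_dotProduct_eq_of_secondaryCone_eq`).

Integer solvability along all independent sets of columns is unimodularity: it gives an adapted
lattice basis and integer inverses for all nonsingular minors
(`isUnimodular_of_forall_exists_dotProduct_eq`). -/

namespace QuadCone

/-! ### Delone cells and the width bound for rank one forms -/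

section Basic

variable {g : ℕ}

lemma toReal_dotProduct (x y : Fin g → ℤ) : toReal x ⬝ᵥ toReal y = ((x ⬝ᵥ y : ℤ) : ℝ) := by
  simp [toReal, dotProduct]

lemma toReal_add (x y : Fin g → ℤ) : toReal (x + y) = toReal x + toReal y := by
  ext i; simp [toReal]

lemma toReal_sub (x y : Fin g → ℤ) : toReal (x - y) = toReal x - toReal y := by
  ext i; simp [toReal]

lemma toReal_neg (x : Fin g → ℤ) : toReal (-x) = -toReal x := by
  ext i; simp [toReal]

lemma toReal_smul (a : ℤ) (x : Fin g → ℤ) : toReal (a • x) = (a : ℝ) • toReal x := by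
  ext i; simp [toReal]

lemma toReal_single (i : Fin g) (a : ℤ) : toReal (Pi.single i a) = Pi.single i (a : ℝ) := by
  ext j
  by_cases h : j = i
  · subst h; simp [toReal]
  · simp [toReal, h]

lemma toReal_injective : Function.Injective (toReal : (Fin g → ℤ) → Fin g → ℝ) := fun x y h => by
  ext i; simpa [toReal] using congrFun h i

lemma toReal_eq_zero {x : Fin g → ℤ} : toReal x = 0 ↔ x = 0 := by
  constructor
  · intro h; apply toReal_injective; rw [h]; ext i; simp [toReal]
  · rintro rfl; ext i; simp [toReal]

lemma value_rankOne (ξ : Fin g → ℤ) (x : Fin g → ℝ) :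
    value (rankOne ξ) x = (toReal ξ ⬝ᵥ x) ^ 2 := by
  simp only [value, rankOne, Matrix.vecMulVec_mulVec, dotProduct_comm x]
  simp [sq]

lemma continuous_value (x : Fin g → ℝ) : Continuous fun Q => value Q x := by
  unfold value
  fun_prop

lemma value_zero (Q : Matrix (Fin g) (Fin g) ℝ) : value Q 0 = 0 := by simp [value]

lemma value_smul (Q : Matrix (Fin g) (Fin g) ℝ) (a : ℝ) (x : Fin g → ℝ) :
    value Q (a • x) = a ^ 2 * value Q x := by
  simp [value, Matrix.mulVec_smul]; ring

lemma value_add_add_value_sub (Q : Matrix (Fin g) (Fin g) ℝ) (x y : Fin g → ℝ) :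
    value Q (x + y) + value Q (x - y) = 2 * value Q x + 2 * value Q y := by
  simp [value, Matrix.mulVec_add, Matrix.mulVec_sub]; ring

lemma value_combo (Q : Matrix (Fin g) (Fin g) ℝ) (x y : Fin g → ℝ) (a b : ℝ) (h : a + b = 1) :
    value Q (a • x + b • y) + a * b * value Q (x - y) = a * value Q x + b * value Q y := by
  obtain rfl : b = 1 - a := by linarith
  simp [value, Matrix.mulVec_add, Matrix.mulVec_sub, Matrix.mulVec_smul]; ring

lemma value_nonneg {Q : Matrix (Fin g) (Fin g) ℝ} (hQ : Q.PosSemidef) (x : Fin g → ℝ) :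
    0 ≤ value Q x := by
  simpa [value] using hQ.dotProduct_mulVec_nonneg x

lemma value_pos {Q : Matrix (Fin g) (Fin g) ℝ} (hQ : Q.PosDef) {x : Fin g → ℝ} (hx : x ≠ 0) :
    0 < value Q x := by
  simpa [value] using hQ.dotProduct_mulVec_pos hx

lemma value_le_of_mem_liftedHull {Q : Matrix (Fin g) (Fin g) ℝ} (hQ : Q.PosSemidef)
    {p : (Fin g → ℝ) × ℝ} (hp : p ∈ liftedHull Q) : value Q p.1 ≤ p.2 := by
  have hc : Convex ℝ {p : (Fin g → ℝ) × ℝ | value Q p.1 ≤ p.2} := by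
    intro p hp q hq a b ha hb hab
    simp only [Set.mem_ofPred_eq, Prod.fst_add, Prod.smul_fst, Prod.snd_add, Prod.smul_snd,
      smul_eq_mul] at hp hq ⊢
    have h1 := value_combo Q p.1 q.1 a b hab
    have h2 := mul_nonneg (mul_nonneg ha hb) (value_nonneg hQ (p.1 - q.1))
    have h3 := mul_le_mul_of_nonneg_left hp ha
    have h4 := mul_le_mul_of_nonneg_left hq hb
    linarith
  refine convexHull_min ?_ hc hp
  rintro _ ⟨x, rfl⟩
  simp

/-- The lattice points at which `Q(x) + c ⬝ x` attains its minimum over the lattice. -/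
def argminLattice (Q : Matrix (Fin g) (Fin g) ℝ) (c : Fin g → ℝ) : Set (Fin g → ℤ) :=
  {x | ∀ y : Fin g → ℤ,
    c ⬝ᵥ toReal x + value Q (toReal x) ≤ c ⬝ᵥ toReal y + value Q (toReal y)}

lemma mem_liftedHull (Q : Matrix (Fin g) (Fin g) ℝ) (x : Fin g → ℤ) :
    (toReal x, value Q (toReal x)) ∈ liftedHull Q :=
  subset_convexHull ℝ _ ⟨x, rfl⟩

lemma exists_cell_of_argminLattice (Q : Matrix (Fin g) (Fin g) ℝ) (c : Fin g → ℝ)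
    (h : (argminLattice Q c).Nonempty) :
    ∃ P ∈ delone Q, ∀ x ∈ argminLattice Q c, toReal x ∈ P := by
  have key : ∀ x ∈ argminLattice Q c, ∀ q ∈ liftedHull Q,
      c ⬝ᵥ toReal x + value Q (toReal x) ≤ c ⬝ᵥ q.1 + q.2 := by
    intro x hx q hq
    have hc : Convex ℝ {q : (Fin g → ℝ) × ℝ |
        c ⬝ᵥ toReal x + value Q (toReal x) ≤ c ⬝ᵥ q.1 + q.2} := by
      refine convex_halfSpace_ge (f := fun q : (Fin g → ℝ) × ℝ => c ⬝ᵥ q.1 + q.2) ?_ _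
      constructor
      · intro p q; simp; ring
      · intro a p; simp; ring
    refine convexHull_min ?_ hc hq
    rintro _ ⟨y, rfl⟩
    exact hx y
  refine ⟨_, ⟨{p ∈ liftedHull Q | ∀ q ∈ liftedHull Q, c ⬝ᵥ p.1 + p.2 ≤ c ⬝ᵥ q.1 + q.2},
    ⟨?_, c, rfl⟩, rfl⟩, ?_⟩
  · obtain ⟨x, hx⟩ := h
    exact ⟨_, mem_liftedHull Q x, key x hx⟩
  · intro x hx
    exact ⟨_, ⟨mem_liftedHull Q x, key x hx⟩, rfl⟩

/-- The face point above a lattice point x need not be (x, Q(x)) a priori, but convexity of Q puts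
it no lower, so (x, Q(x)) attains the minimum as well. -/
lemma exists_argminLattice_of_cell {Q : Matrix (Fin g) (Fin g) ℝ} (hQ : Q.PosSemidef)
    {P : Set (Fin g → ℝ)} (hP : P ∈ delone Q) :
    ∃ c : Fin g → ℝ, ∀ x : Fin g → ℤ, toReal x ∈ P → x ∈ argminLattice Q c := by
  obtain ⟨F, ⟨-, c, rfl⟩, rfl⟩ := hP
  refine ⟨c, ?_⟩
  rintro x ⟨p, ⟨hp, hmin⟩, hpx⟩ y
  have h1 := value_le_of_mem_liftedHull hQ hp
  have h2 := hmin _ (mem_liftedHull Q y)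
  rw [hpx] at h1 h2
  simp only at h2
  linarith

/-- Two lattice points of a common cell cannot be moved towards each other without increasing the
sum of the values of a form in the secondary cone. -/
lemma value_add_value_le_of_mem_secondaryCone {D : Set (Set (Fin g → ℝ))}
    {P : Set (Fin g → ℝ)} (hP : P ∈ D) {R : Matrix (Fin g) (Fin g) ℝ} (hR : R ∈ secondaryCone D)
    {p q : Fin g → ℤ} (hp : toReal p ∈ P) (hq : toReal q ∈ P) (u : Fin g → ℤ) :
    value R (toReal p) + value R (toReal q) ≤
      value R (toReal (p - u)) + value R (toReal (q + u)) := by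
  have hcl : IsClosed {R : Matrix (Fin g) (Fin g) ℝ | value R (toReal p) + value R (toReal q) ≤
      value R (toReal (p - u)) + value R (toReal (q + u))} :=
    isClosed_le ((continuous_value _).add (continuous_value _))
      ((continuous_value _).add (continuous_value _))
  refine closure_minimal ?_ hcl hR
  rintro Q ⟨hQ, rfl⟩
  -- Both p and q minimize Q + c. Comparing them with p - u and q + u and adding, the linear terms
  -- cancel; what remains is a closed condition on Q.
  obtain ⟨c, hc⟩ := exists_argminLattice_of_cell hQ.1 hP
  have h1 := hc p hp (p - u)
  have h2 := hc q hq (q + u)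
  simp only [toReal_sub, toReal_add, dotProduct_sub, dotProduct_add] at h1 h2 ⊢
  simp only [Set.mem_ofPred_eq]
  linarith

/-- With a = ξ ⬝ p and b = ξ ⬝ q, the preceding inequality reads a² + b² ≤ (a - 1)² + (b + 1)², that
is, a - b ≤ 1. -/
lemma dotProduct_sub_dotProduct_le_one {D : Set (Set (Fin g → ℝ))}
    {P : Set (Fin g → ℝ)} (hP : P ∈ D) {ξ u : Fin g → ℤ} (hξ : rankOne ξ ∈ secondaryCone D)
    (hu : ξ ⬝ᵥ u = 1) {p q : Fin g → ℤ} (hp : toReal p ∈ P) (hq : toReal q ∈ P) :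
    ξ ⬝ᵥ p - ξ ⬝ᵥ q ≤ 1 := by
  have h := value_add_value_le_of_mem_secondaryCone hP hξ hp hq u
  simp only [value_rankOne, toReal_dotProduct, dotProduct_sub, dotProduct_add, hu] at h
  norm_cast at h
  nlinarith

end Basic

/-! ### Minimal vectors and a simple matrix of generators -/

section MinimalVectors

variable {g : ℕ} {Q : Matrix (Fin g) (Fin g) ℝ}

lemma minimalVectors_ne_zero (hQ : Q.PosDef) {ξ : Fin g → ℤ} (hξ : ξ ∈ minimalVectors Q) :
    ξ ≠ 0 := by
  rintro rfl
  obtain ⟨η, hη, h⟩ := hξ.1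
  have := value_pos hQ (mt toReal_eq_zero.1 hη)
  simp only [toReal_eq_zero.2 rfl, value_zero] at h
  linarith

lemma minimalVectors_le {ξ : Fin g → ℤ} (hξ : ξ ∈ minimalVectors Q) {η : Fin g → ℤ}
    (hη : η ≠ 0) : value Q (toReal ξ) ≤ value Q (toReal η) :=
  hξ.2 ⟨η, hη, rfl⟩

lemma minimalVectors_value_eq {ξ η : Fin g → ℤ} (hξ : ξ ∈ minimalVectors Q)
    (hη : η ∈ minimalVectors Q) : value Q (toReal ξ) = value Q (toReal η) :=
  hξ.unique hη

/-- A minimal vector is primitive: if ξ = dη, then minimality against η forces d² ≤ 1. Bézout then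
supplies u. -/
lemma minimalVectors_exists_dotProduct_eq_one (hQ : Q.PosDef) {ξ : Fin g → ℤ}
    (hξ : ξ ∈ minimalVectors Q) : ∃ u : Fin g → ℤ, ξ ⬝ᵥ u = 1 := by
  set I := Ideal.span (Set.range ξ)
  set d := Submodule.IsPrincipal.generator I
  have hd : d ∈ I := Submodule.IsPrincipal.generator_mem I
  have hdvd : ∀ i, d ∣ ξ i := fun i =>
    (Submodule.IsPrincipal.mem_iff_generator_dvd I).1 (Ideal.subset_span ⟨i, rfl⟩)
  choose η hη using hdvd
  have hξη : ξ = d • η := by ext i; simp [hη]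
  have h0 := minimalVectors_ne_zero hQ hξ
  have hd0 : d ≠ 0 := by intro h; rw [h, zero_smul] at hξη; exact h0 hξη
  have hη0 : η ≠ 0 := by intro h; rw [h, smul_zero] at hξη; exact h0 hξη
  have hle := minimalVectors_le hξ hη0
  have hpos := value_pos hQ (mt toReal_eq_zero.1 hη0)
  rw [hξη, toReal_smul, value_smul] at hle
  have hd1 : (d : ℝ) ^ 2 ≤ 1 := by
    by_contra h
    nlinarith
  have hd2 : d ^ 2 = 1 := by
    have : d ^ 2 ≤ 1 := by exact_mod_cast hd1
    have : 0 < d ^ 2 := by positivity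
    omega
  obtain ⟨u, hu⟩ := Ideal.mem_span_range_iff_exists_fun.1 hd
  refine ⟨d • u, ?_⟩
  have : ξ ⬝ᵥ u = d := by rw [← hu, dotProduct]; exact Finset.sum_congr rfl fun i _ => mul_comm _ _
  rw [dotProduct_smul, this, smul_eq_mul, ← sq, hd2]

/-- Otherwise (ξ - η)/2 and (ξ + η)/2 are nonzero lattice vectors, and by the parallelogram law
their values sum to the minimum, although each is at least the minimum. -/
lemma minimalVectors_eq_or_eq_neg (hQ : Q.PosDef) {ξ η : Fin g → ℤ} (hξ : ξ ∈ minimalVectors Q)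
    (hη : η ∈ minimalVectors Q) (h : ∀ i, (ξ i : ZMod 2) = η i) : ξ = η ∨ ξ = -η := by
  by_contra! hne
  have hdvd : ∀ i, (2 : ℤ) ∣ ξ i - η i := fun i => by
    have := (ZMod.intCast_eq_intCast_iff_dvd_sub (η i) (ξ i) 2).1 (h i).symm
    exact_mod_cast this
  choose b hb using hdvd
  have e1 : ξ - η = (2 : ℤ) • b := by ext i; simp [hb]
  have e2 : ξ + η = (2 : ℤ) • (b + η) := by ext i; simp; linarith [hb i]
  have hb0 : b ≠ 0 := by
    rintro rfl; exact hne.1 (sub_eq_zero.1 (by simpa using e1))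
  have hb1 : b + η ≠ 0 := by
    intro h0; rw [h0, smul_zero] at e2; exact hne.2 (eq_neg_of_add_eq_zero_left e2)
  have l1 := minimalVectors_le hξ hb0
  have l2 := minimalVectors_le hξ hb1
  have par := value_add_add_value_sub Q (toReal ξ) (toReal η)
  rw [← toReal_add, ← toReal_sub, e1, e2, toReal_smul, toReal_smul, value_smul, value_smul,
    minimalVectors_value_eq hη hξ] at par
  have hpos := value_pos hQ (mt toReal_eq_zero.1 (minimalVectors_ne_zero hQ hξ))
  push_cast at par
  linarith

lemma rankOne_neg (ξ : Fin g → ℤ) : rankOne (-ξ) = rankOne ξ := by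
  ext i j; simp [rankOne, toReal, Matrix.vecMulVec_apply]

/-- Choosing one vector from each pair `±ξ` of minimal vectors gives a simple matrix. -/
lemma exists_simple_matrix (hQ : Q.PosDef) :
    ∃ (n : ℕ) (A : Matrix (Fin g) (Fin n) ℤ), IsSimple A ∧ (∀ j, A.col j ∈ minimalVectors Q) ∧
      perfectCone Q = matroidalCone A := by
  classical
  -- Residues modulo 2 separate minimal vectors up to sign, which also shows that there are finitely
  -- many.
  let r : (Fin g → ℤ) → Fin g → ZMod 2 := fun ξ i => (ξ i : ZMod 2)
  let S := r '' minimalVectors Q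
  obtain ⟨n, ⟨e⟩⟩ := Finite.exists_equiv_fin S
  have hch : ∀ s : S, ∃ ξ ∈ minimalVectors Q, r ξ = s := fun s => s.2
  choose f hf hrf using hch
  let A : Matrix (Fin g) (Fin n) ℤ := Matrix.of fun i j => f (e.symm j) i
  have hcol : ∀ j, A.col j = f (e.symm j) := fun j => rfl
  refine ⟨n, A, ⟨?_, ?_⟩, fun j => hf _, ?_⟩
  · intro j
    rw [hcol]
    exact minimalVectors_ne_zero hQ (hf _)
  · intro i j hij c hc
    rw [hcol, hcol] at hc
    apply hij
    have hv := minimalVectors_value_eq (hf (e.symm i)) (hf (e.symm j))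
    have hpos := value_pos hQ (mt toReal_eq_zero.1 (minimalVectors_ne_zero hQ (hf (e.symm j))))
    rw [hc, value_smul] at hv
    have hc2 : c ^ 2 = 1 := by
      have : (c ^ 2 - 1) * value Q (toReal (f (e.symm j))) = 0 := by linarith
      rcases mul_eq_zero.1 this with h | h
      · linarith
      · exact absurd h hpos.ne'
    have hr : r (f (e.symm i)) = r (f (e.symm j)) := by
      rcases (by simpa using hc2 : c = 1 ∨ c = -1) with rfl | rfl
      · rw [one_smul] at hc
        rw [toReal_injective hc]
      · have : f (e.symm i) = -f (e.symm j) := toReal_injective (by rw [hc, toReal_neg, neg_one_smul])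
        rw [this]
        ext k
        simp only [r, Pi.neg_apply, Int.cast_neg]
        exact ZMod.neg_eq_self_mod_two _
    rw [hrf, hrf] at hr
    exact e.symm.injective (Subtype.ext hr)
  · unfold perfectCone matroidalCone
    congr 2
    ext R
    constructor
    · rintro ⟨ξ, hξ, rfl⟩
      let s : S := ⟨r ξ, ξ, hξ, rfl⟩
      refine ⟨e s, ?_⟩
      simp only [hcol, Equiv.symm_apply_apply]
      rcases minimalVectors_eq_or_eq_neg hQ hξ (hf s) (fun i => (congrFun (hrf s) i).symm) with h | h
      · rw [← h]
      · rw [h, rankOne_neg]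
    · rintro ⟨j, rfl⟩
      exact ⟨_, hf _, rfl⟩

end MinimalVectors

/-! ### Delone cells cover the space modulo the null space -/

section Covering

lemma finite_setOf_quadratic_le {ι : Type*} [Fintype ι] {l : ι → ℝ} (hl : ∀ i, 0 < l i)
    (b : ι → ℝ) (K : ℝ) :
    {t : ι → ℤ | ∑ i, (l i * (t i : ℝ) ^ 2 + b i * t i) ≤ K}.Finite := by
  classical
  have hlow : ∀ (t : ι → ℤ) (i : ι),
      l i / 2 * (t i : ℝ) ^ 2 - b i ^ 2 / (2 * l i) ≤ l i * (t i : ℝ) ^ 2 + b i * t i := by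
    intro t i
    have h := hl i
    have : l i * (t i : ℝ) ^ 2 + b i * t i - (l i / 2 * (t i : ℝ) ^ 2 - b i ^ 2 / (2 * l i)) =
        (l i * t i + b i) ^ 2 / (2 * l i) := by field_simp; ring
    have h2 : 0 ≤ (l i * t i + b i) ^ 2 / (2 * l i) := by positivity
    linarith
  set K' := K + ∑ i, b i ^ 2 / (2 * l i) with hK'
  have hbd : ∀ i, ∃ N : ℕ, 2 * K' / l i < N := fun i => exists_nat_gt _
  choose N hN using hbd
  refine (Set.finite_Icc (fun i => -(N i : ℤ)) (fun i => (N i : ℤ))).subset ?_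
  intro t ht
  have hsum : ∑ i, l i / 2 * (t i : ℝ) ^ 2 ≤ K' := by
    have := (Finset.sum_le_sum fun i (_ : i ∈ Finset.univ) => hlow t i).trans ht
    rw [Finset.sum_sub_distrib] at this
    linarith
  have hi : ∀ i, |t i| ≤ (N i : ℤ) := by
    intro i
    have h1 : l i / 2 * (t i : ℝ) ^ 2 ≤ K' := by
      refine le_trans ?_ hsum
      exact Finset.single_le_sum (f := fun i => l i / 2 * (t i : ℝ) ^ 2)
        (fun j _ => by have := hl j; positivity) (Finset.mem_univ i)
    have h2 : (t i : ℝ) ^ 2 ≤ 2 * K' / l i := by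
      rw [le_div_iff₀ (hl i)]; linarith
    have h3 : (t i) ^ 2 ≤ (N i : ℤ) := by
      have : ((t i : ℝ)) ^ 2 ≤ N i := h2.trans (hN i).le
      exact_mod_cast this
    have h4 : |t i| ≤ (t i) ^ 2 := by
      rw [← sq_abs]
      exact Int.le_self_sq _
    exact h4.trans h3
  exact ⟨fun i => (abs_le.1 (hi i)).1, fun i => (abs_le.1 (hi i)).2⟩

/-- Among the affine functions below a nonnegative function on the lattice, one is maximal at a
given point. -/
lemma exists_maximal_affine_minorant {g : ℕ} {q : (Fin g → ℤ) → ℝ} (hq : ∀ x, 0 ≤ q x)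
    (y : Fin g → ℝ) :
    ∃ (c : Fin g → ℝ) (r : ℝ), (∀ x, r ≤ q x - c ⬝ᵥ (toReal x - y)) ∧
      ∀ (c' : Fin g → ℝ) (r' : ℝ), (∀ x, r' ≤ q x - c' ⬝ᵥ (toReal x - y)) → r' ≤ r := by
  set Y := ∑ i, |y i| with hY
  have hY0 : 0 ≤ Y := Finset.sum_nonneg fun i _ => abs_nonneg _
  obtain ⟨N, hN⟩ := exists_nat_gt (Y + 1)
  set C := ∑ i, (q (Pi.single i (N : ℤ)) + q (Pi.single i (-(N : ℤ)))) with hC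
  have hC0 : 0 ≤ C := Finset.sum_nonneg fun i _ => add_nonneg (hq _) (hq _)
  have hcy : ∀ c : Fin g → ℝ, c ⬝ᵥ y ≤ ‖c‖ * Y := by
    intro c
    rw [hY, Finset.mul_sum, dotProduct]
    refine Finset.sum_le_sum fun i _ => ?_
    calc c i * y i ≤ |c i * y i| := le_abs_self _
      _ = |c i| * |y i| := abs_mul _ _
      _ ≤ ‖c‖ * |y i| := mul_le_mul_of_nonneg_right (norm_le_pi_norm c i) (abs_nonneg _)
  let K : Set ((Fin g → ℝ) × ℝ) :=
    {p | 0 ≤ p.2 ∧ ∀ x : Fin g → ℤ, p.2 ≤ q x - p.1 ⬝ᵥ (toReal x - y)}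
  have hKc : IsClosed K := by
    refine (isClosed_le continuous_const continuous_snd).inter ?_
    change IsClosed {p : (Fin g → ℝ) × ℝ | ∀ x : Fin g → ℤ, p.2 ≤ q x - p.1 ⬝ᵥ (toReal x - y)}
    have : {p : (Fin g → ℝ) × ℝ | ∀ x : Fin g → ℤ, p.2 ≤ q x - p.1 ⬝ᵥ (toReal x - y)} =
        ⋂ x : Fin g → ℤ, {p : (Fin g → ℝ) × ℝ | p.2 ≤ q x - p.1 ⬝ᵥ (toReal x - y)} := by
      ext p; simp
    rw [this]
    refine isClosed_iInter fun x => isClosed_le continuous_snd ?_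
    exact continuous_const.sub (continuous_fst.dotProduct continuous_const)
  have hKb : K ⊆ Metric.closedBall 0 C ×ˢ Set.Icc 0 (q 0 + C * Y) := by
    rintro ⟨c, r⟩ ⟨hr0, hf⟩
    simp only at hr0 hf
    -- Testing the minorant at ±N times the i-th basis vector bounds c; since N > Y + 1, the term
    -- ‖c‖ * Y is absorbed.
    have hci : ∀ i, N * |c i| ≤ C + ‖c‖ * Y := by
      intro i
      have hle : q (Pi.single i (N : ℤ)) + q (Pi.single i (-(N : ℤ))) ≤ C :=
        Finset.single_le_sum
          (f := fun i => q (Pi.single i (N : ℤ)) + q (Pi.single i (-(N : ℤ))))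
          (fun i _ => add_nonneg (hq _) (hq _)) (Finset.mem_univ i)
      have h1 := hf (Pi.single i (N : ℤ))
      have h2 := hf (Pi.single i (-(N : ℤ)))
      simp only [toReal_single, dotProduct_sub, dotProduct_single] at h1 h2
      push_cast at h1 h2
      have h3 := hcy c
      have h4 := hq (Pi.single i (N : ℤ))
      have h5 := hq (Pi.single i (-(N : ℤ)))
      rcases abs_cases (c i) with ⟨h, -⟩ | ⟨h, -⟩ <;> rw [h] <;> linarith
    have hc : ‖c‖ ≤ C := by
      have hc0 := norm_nonneg c
      have hN0 : (0 : ℝ) < N := by linarith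
      have h1 : ‖c‖ ≤ (C + ‖c‖ * Y) / N := by
        refine (pi_norm_le_iff_of_nonneg (by positivity)).2 fun i => ?_
        rw [le_div_iff₀ hN0, mul_comm]
        exact hci i
      rw [le_div_iff₀ hN0] at h1
      nlinarith
    refine ⟨by simpa using hc, hr0, ?_⟩
    have h0 := hf 0
    rw [toReal_eq_zero.2 rfl, zero_sub, dotProduct_neg] at h0
    have h1 := hcy c
    have h2 := mul_le_mul_of_nonneg_right hc hY0
    linarith
  have hK : IsCompact K :=
    ((isCompact_closedBall _ _).prod isCompact_Icc).of_isClosed_subset hKc hKb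
  obtain ⟨⟨c, r⟩, ⟨hr0, hcr⟩, hmax⟩ := hK.exists_isMaxOn (f := Prod.snd)
    ⟨0, le_rfl, fun x => by simpa using hq x⟩ continuous_snd.continuousOn
  refine ⟨c, r, hcr, fun c' r' h' => ?_⟩
  by_cases hr' : 0 ≤ r'
  · exact hmax (show (c', r') ∈ K from ⟨hr', h'⟩)
  · exact (not_le.1 hr').le.trans hr0

lemma eq_zero_of_forall_intCast_mul_le {a B : ℝ} (h : ∀ k : ℤ, k * a ≤ B) : a = 0 := by
  by_contra ha
  obtain ⟨n, hn⟩ := exists_nat_gt (B / |a|)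
  have hpos : 0 < |a| := abs_pos.2 ha
  rw [div_lt_iff₀ hpos] at hn
  have h1 := h n
  have h2 := h (-n)
  push_cast at h1 h2
  rcases abs_cases a with ⟨h, -⟩ | ⟨h, -⟩ <;> rw [h] at hn <;> linarith

/-- The cells of the Delone subdivision cover the space, up to the kernel of the form. -/
lemma exists_mem_convexHull_argminLattice {g : ℕ} {ι : Type*} [Fintype ι] {l : ι → ℝ}
    (hl : ∀ i, 0 < l i) (ξ : ι → Fin g → ℤ) {Q : Matrix (Fin g) (Fin g) ℝ}
    (hQ : ∀ x, value Q x = ∑ i, l i * (toReal (ξ i) ⬝ᵥ x) ^ 2)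
    (hker : ∀ w, (∀ i, toReal (ξ i) ⬝ᵥ w = 0) →
      w ∈ Submodule.span ℝ (toReal '' {z | ∀ i, ξ i ⬝ᵥ z = 0}))
    (y : Fin g → ℝ) :
    ∃ c, ∃ p ∈ convexHull ℝ (toReal '' argminLattice Q c),
      ∀ i, toReal (ξ i) ⬝ᵥ p = toReal (ξ i) ⬝ᵥ y := by
  classical
  have hQ0 : ∀ x, 0 ≤ value Q x := fun x => by
    rw [hQ]; exact Finset.sum_nonneg fun i _ => mul_nonneg (hl i).le (sq_nonneg _)
  obtain ⟨c, r, hcr, hmax⟩ := exists_maximal_affine_minorant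
    (q := fun x => value Q (toReal x)) (fun x => hQ0 _) y
  let Ξ : (Fin g → ℝ) →ₗ[ℝ] (ι → ℝ) :=
    Matrix.mulVecLin (Matrix.of fun (k : ι) (i : Fin g) => toReal (ξ k) i)
  have hΞ : ∀ x i, Ξ x i = toReal (ξ i) ⬝ᵥ x := fun x i => rfl
  let τ : (Fin g → ℤ) → ι → ℤ := fun x i => ξ i ⬝ᵥ x
  have hτ : ∀ x i, Ξ (toReal x) i = (τ x i : ℝ) := fun x i => by
    rw [hΞ, toReal_dotProduct]
  -- the linear part vanishes on the kernel, so it factors through `Ξ`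
  have hcz : ∀ z : Fin g → ℤ, (∀ i, ξ i ⬝ᵥ z = 0) → c ⬝ᵥ toReal z = 0 := by
    intro z hz
    refine eq_zero_of_forall_intCast_mul_le (B := c ⬝ᵥ y - r) fun k => ?_
    have h := hcr (k • z)
    simp only [hQ, toReal_smul, dotProduct_smul, toReal_dotProduct, hz, dotProduct_sub] at h
    simp at h
    linarith
  have hcw : ∀ w, Ξ w = 0 → c ⬝ᵥ w = 0 := by
    intro w hw
    refine Submodule.span_induction (p := fun w _ => c ⬝ᵥ w = 0) ?_ ?_ ?_ ?_
      (hker w fun i => by rw [← hΞ, hw]; rfl)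
    · rintro _ ⟨z, hz, rfl⟩
      exact hcz z hz
    · exact dotProduct_zero c
    · intro x y _ _ hx hy
      rw [dotProduct_add, hx, hy, add_zero]
    · intro a x _ hx
      rw [dotProduct_smul, hx, smul_zero]
  obtain ⟨b, hb⟩ : ∃ b : ι → ℝ, ∀ x, c ⬝ᵥ x = ∑ i, b i * Ξ x i := by
    let cl : Module.Dual ℝ (Fin g → ℝ) := dotProductBilin ℝ ℝ c
    have hmem : cl ∈ LinearMap.range Ξ.dualMap := by
      rw [LinearMap.range_dualMap_eq_dualAnnihilator_ker Ξ, Submodule.mem_dualAnnihilator]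
      exact fun w hw => hcw w hw
    obtain ⟨φ, hφ⟩ := hmem
    refine ⟨fun i => φ (Pi.single i 1), fun x => ?_⟩
    have h1 : c ⬝ᵥ x = φ (Ξ x) := (LinearMap.congr_fun hφ x).symm
    rw [h1, LinearMap.pi_apply_eq_sum_univ φ]
    refine Finset.sum_congr rfl fun i _ => ?_
    rw [smul_eq_mul, mul_comm]
    congr 2
    ext j; simp [Pi.single_apply, eq_comm]
  -- The gap between Q and its maximal affine minorant, as a function of the coordinates `Ξ`. It is
  -- coercive there, hence small at only finitely many integer points.
  let F : (ι → ℝ) → ℝ := fun t => ∑ i, (l i * t i ^ 2 - b i * t i) + (c ⬝ᵥ y - r)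
  have hF : ∀ x : Fin g → ℤ,
      F (Ξ (toReal x)) = value Q (toReal x) - c ⬝ᵥ (toReal x - y) - r := by
    intro x
    simp only [F, hQ, dotProduct_sub, hb (toReal x), Finset.sum_sub_distrib, hΞ]
    ring
  have hF0 : ∀ x : Fin g → ℤ, 0 ≤ F (Ξ (toReal x)) := fun x => by
    rw [hF]; linarith [hcr x]
  have hfin : ∀ (β : ι → ℝ) (u : ℝ),
      {t : ι → ℤ | F (fun i => t i) - (∑ i, β i * t i - u) ≤ 0}.Finite := by
    intro β u
    refine (finite_setOf_quadratic_le hl (fun i => - b i - β i) (r - c ⬝ᵥ y - u)).subset ?_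
    intro t ht
    have e : ∑ i, (l i * (t i : ℝ) ^ 2 + (-b i - β i) * t i) =
        ∑ i, (l i * (t i : ℝ) ^ 2 - b i * t i) - ∑ i, β i * t i := by
      rw [← Finset.sum_sub_distrib]; exact Finset.sum_congr rfl fun i _ => by ring
    simp only [F, Set.mem_ofPred_eq, e] at ht ⊢
    linarith
  let T : Set (Fin g → ℤ) := {x | F (Ξ (toReal x)) = 0}
  have hΞτ : ∀ x, Ξ (toReal x) = fun i => (τ x i : ℝ) := fun x => funext (hτ x)
  have hTfin : (Ξ '' (toReal '' T)).Finite := by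
    refine ((hfin 0 0).image fun t i => (t i : ℝ)).subset ?_
    rintro _ ⟨_, ⟨x, hx, rfl⟩, rfl⟩
    refine ⟨τ x, ?_, (hΞτ x).symm⟩
    have hx' : F (Ξ (toReal x)) = 0 := hx
    rw [hΞτ] at hx'
    simp [hx']
  -- If y were not over the hull of the contact points, tilting the minorant by a small multiple of
  -- a separating functional would keep it below Q and raise its value at y.
  have hy : Ξ y ∈ convexHull ℝ (Ξ '' (toReal '' T)) := by
    by_contra hy
    obtain ⟨f, u, hfT, hfy⟩ := geometric_hahn_banach_closed_point (convex_convexHull ℝ _)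
      (hTfin.isCompact_convexHull ℝ).isClosed hy
    let β : ι → ℝ := fun i => f (Pi.single i 1)
    have hfβ : ∀ t, f t = ∑ i, β i * t i := by
      intro t
      have := LinearMap.pi_apply_eq_sum_univ (f : (ι → ℝ) →ₗ[ℝ] ℝ) t
      simp only [ContinuousLinearMap.coe_coe] at this
      rw [this]
      refine Finset.sum_congr rfl fun i _ => ?_
      rw [smul_eq_mul, mul_comm]
      congr 2
      ext j; simp [Pi.single_apply, eq_comm]
    have hS := hfin β u
    set S := {t : ι → ℤ | F (fun i => t i) - (∑ i, β i * t i - u) ≤ 0} with hSdef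
    have hev : ∀ᶠ ε : ℝ in nhdsWithin 0 (Set.Ioi 0), ∀ t ∈ S, ∀ x, τ x = t →
        ε * (f (Ξ (toReal x)) - u) ≤ F (Ξ (toReal x)) := by
      rw [Filter.eventually_all_finite hS]
      intro t _
      by_cases ht : ∃ x, τ x = t
      · obtain ⟨x, rfl⟩ := ht
        have hsuff : ∀ᶠ ε : ℝ in nhdsWithin 0 (Set.Ioi 0),
            ε * (f (Ξ (toReal x)) - u) ≤ F (Ξ (toReal x)) := by
          rcases (hF0 x).eq_or_lt with h | h
          · have hneg : f (Ξ (toReal x)) < u :=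
              hfT _ (subset_convexHull ℝ _ ⟨_, ⟨x, h.symm, rfl⟩, rfl⟩)
            filter_upwards [self_mem_nhdsWithin] with ε hε
            have hε' : 0 < ε := hε
            rw [← h]
            nlinarith
          · have hcont : Continuous fun ε : ℝ => ε * (f (Ξ (toReal x)) - u) := by fun_prop
            have := hcont.tendsto 0
            rw [zero_mul] at this
            exact ((this.mono_left nhdsWithin_le_nhds).eventually (gt_mem_nhds h)).mono
              fun ε hε => le_of_lt hε
        filter_upwards [hsuff] with ε hε x' hx'
        rw [hΞτ] at hε ⊢
        rwa [hx']
      · exact Filter.Eventually.of_forall fun ε x hx => absurd ⟨x, hx⟩ ht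
    obtain ⟨ε, hε, hε0, hε1⟩ := (hev.and (Ioo_mem_nhdsGT (zero_lt_one (α := ℝ)))).exists
    have hmain : ∀ x : Fin g → ℤ, ε * (f (Ξ (toReal x)) - u) ≤ F (Ξ (toReal x)) := by
      intro x
      by_cases hx : τ x ∈ S
      · exact hε _ hx x rfl
      -- Off the finite set S the gap exceeds both 0 (weakly) and f - u, so any ε in (0, 1) works.
      · have hx' : 0 < F (Ξ (toReal x)) - (f (Ξ (toReal x)) - u) := by
          rw [hfβ, hΞτ]
          exact not_le.1 hx
        have := hF0 x
        nlinarith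
    have hc' : ∀ v, (c + ε • ∑ i, β i • toReal (ξ i)) ⬝ᵥ v = c ⬝ᵥ v + ε * f (Ξ v) := by
      intro v
      rw [add_dotProduct, smul_dotProduct, sum_dotProduct, hfβ]
      simp [hΞ]
    have := hmax (c + ε • ∑ i, β i • toReal (ξ i)) (r + ε * (f (Ξ y) - u)) fun x => by
      have h := hmain x
      rw [hF] at h
      rw [hc', map_sub, map_sub]
      linarith
    have hpos : 0 < ε * (f (Ξ y) - u) := mul_pos hε0 (by linarith)
    linarith
  rw [← LinearMap.image_convexHull Ξ] at hy
  obtain ⟨p, hp, hpy⟩ := hy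
  -- The minorant has slope c, whereas `argminLattice` adds its linear form to Q; hence the sign.
  refine ⟨-c, p, convexHull_mono (Set.image_mono ?_) hp, fun i => ?_⟩
  · intro x hx x'
    have h1 : F (Ξ (toReal x)) = 0 := hx
    have h2 := hF0 x'
    rw [hF, dotProduct_sub] at h1 h2
    rw [neg_dotProduct, neg_dotProduct]
    linarith
  · rw [← hΞ, hpy, hΞ]

end Covering

/-! ### A solvability criterion for unimodularity -/

section Unimodular

/-- If integer equations along any linearly independent columns of `A` can be solved over the
integers, then `A` is unimodular. -/
lemma isUnimodular_of_forall_exists_dotProduct_eq {g n : ℕ} (A : Matrix (Fin g) (Fin n) ℤ)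
    (hA : ∀ (ι : Type) [Fintype ι] (s : ι → Fin n),
      LinearIndependent ℝ (fun i => toReal (A.col (s i))) →
        ∀ m : ι → ℤ, ∃ x : Fin g → ℤ, ∀ i, A.col (s i) ⬝ᵥ x = m i) :
    IsUnimodular A := by
  classical
  obtain ⟨κ, a, ha, hspan, hind⟩ := exists_linearIndependent' ℝ fun j => toReal (A.col j)
  have : Finite κ := Finite.of_injective a ha
  have : Fintype κ := Fintype.ofFinite κ
  have hx : ∀ k : κ, ∃ x : Fin g → ℤ, ∀ i, A.col (a i) ⬝ᵥ x = if i = k then 1 else 0 :=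
    fun k => hA κ a hind _
  choose x hx using hx
  -- The x k are dual to the chosen basis of columns, so every column has integer coordinates A.col
  -- j ⬝ᵥ x k in that basis.
  have hexp : ∀ (j : Fin n) (z : Fin g → ℤ),
      A.col j ⬝ᵥ z = ∑ k, (A.col j ⬝ᵥ x k) * (A.col (a k) ⬝ᵥ z) := by
    intro j z
    have hj : toReal (A.col j) ∈
        Submodule.span ℝ (Set.range ((fun j => toReal (A.col j)) ∘ a)) := by
      rw [hspan]; exact Submodule.subset_span ⟨j, rfl⟩
    obtain ⟨γ, hγ⟩ := (Submodule.mem_span_range_iff_exists_fun ℝ).1 hj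
    have hdot : ∀ z : Fin g → ℤ,
        ((A.col j ⬝ᵥ z : ℤ) : ℝ) = ∑ k, γ k * ((A.col (a k) ⬝ᵥ z : ℤ) : ℝ) := by
      intro z
      simp only [← toReal_dotProduct]
      rw [← hγ, sum_dotProduct]
      simp
    have hγx : ∀ k, ((A.col j ⬝ᵥ x k : ℤ) : ℝ) = γ k := by
      intro k
      rw [hdot]
      simp [hx]
    have := hdot z
    simp only [← hγx] at this
    exact_mod_cast this
  let φ : (Fin g → ℤ) →ₗ[ℤ] (κ → ℤ) :=
    Matrix.mulVecLin (Matrix.of fun (k : κ) (i : Fin g) => A.col (a k) i)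
  have hφ : ∀ z k, φ z k = A.col (a k) ⬝ᵥ z := fun z k => rfl
  -- The dual vectors split the lattice as ker φ ⊕ ℤ^κ. In the resulting basis, `H * A` consists of
  -- zero rows and of the coordinate rows from `hexp`.
  let ψ : (LinearMap.ker φ × (κ → ℤ)) →ₗ[ℤ] (Fin g → ℤ) :=
    (LinearMap.ker φ).subtype.coprod (Fintype.linearCombination ℤ x)
  have hφx : ∀ α : κ → ℤ, φ (Fintype.linearCombination ℤ x α) = α := by
    intro α
    ext k
    simp only [hφ, Fintype.linearCombination_apply, dotProduct_sum, dotProduct_smul, hx]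
    simp
  have hψ : Function.Bijective ψ := by
    constructor
    · rw [injective_iff_map_eq_zero]
      rintro ⟨w, α⟩ h
      simp only [ψ, LinearMap.coprod_apply, Submodule.subtype_apply] at h
      have h1 := congrArg φ h
      rw [map_add, hφx, map_zero, LinearMap.mem_ker.1 w.2, zero_add] at h1
      subst h1
      simpa using h
    · intro z
      refine ⟨⟨⟨z - Fintype.linearCombination ℤ x (φ z), ?_⟩, φ z⟩, ?_⟩
      · rw [LinearMap.mem_ker, map_sub, hφx, sub_self]
      · simp [ψ]
  let b₀ := ((Module.Free.chooseBasis ℤ (LinearMap.ker φ)).prod (Pi.basisFun ℤ κ)).map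
    (LinearEquiv.ofBijective ψ hψ)
  have hcard : Fintype.card (Module.Free.ChooseBasisIndex ℤ (LinearMap.ker φ) ⊕ κ) = g := by
    rw [← Module.finrank_eq_card_basis b₀]; simp
  let e := Fintype.equivFinOfCardEq hcard
  let b := b₀.reindex e
  have hbl : ∀ l k, A.col (a k) ⬝ᵥ b (e (Sum.inl l)) = 0 := by
    intro l k
    rw [← hφ]
    simp [b, b₀, ψ]
  have hbr : ∀ k, b (e (Sum.inr k)) = x k := by
    intro k
    simp [b, b₀, ψ]
  let H : Matrix (Fin g) (Fin g) ℤ := Matrix.of fun i j => b i j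
  have hH : IsUnit H := by
    have h1 : H = ((Pi.basisFun ℤ (Fin g)).toMatrix b)ᵀ := by
      ext i j; simp [H, Module.Basis.toMatrix_apply]
    rw [h1, Matrix.isUnit_transpose]
    have := (Pi.basisFun ℤ (Fin g)).invertibleToMatrix b
    exact isUnit_of_invertible _
  refine ⟨hH.unit, ?_⟩
  rw [IsUnit.unit_spec]
  have hHA : ∀ i j, (H * A) i j = A.col j ⬝ᵥ b i := fun i j => dotProduct_comm _ _
  intro k f s hf hs
  by_cases hdet : ((H * A).submatrix f s).det = 0
  · exact ⟨0, by simp [hdet]⟩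
  have hc : ∀ i, ∃ c : κ, f i = e (Sum.inr c) := by
    intro i
    rcases he : e.symm (f i) with l | c
    · refine absurd (Matrix.det_eq_zero_of_row_eq_zero i fun j => ?_) hdet
      rw [Matrix.submatrix_apply, hHA, hexp]
      have : f i = e (Sum.inl l) := by rw [← he, Equiv.apply_symm_apply]
      simp [this, hbl]
    · exact ⟨c, by rw [← he, Equiv.apply_symm_apply]⟩
  choose c hc using hc
  have hcinj : Function.Injective c := fun i j h => hf (by rw [hc, hc, h])
  set M := (H * A).submatrix f s with hM
  have hMij : ∀ i j, M i j = A.col (s j) ⬝ᵥ x (c i) := by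
    intro i j
    rw [hM, Matrix.submatrix_apply, hHA, hc, hbr]
  -- Exchange: as the minor is nonzero, the columns s j may replace the basis columns a (c i)
  -- without losing independence.
  have hli : LinearIndependent ℝ (fun i : Fin k ⊕ {b : κ // b ∉ Set.range c} =>
      toReal (A.col (Sum.elim s (fun b : {b : κ // b ∉ Set.range c} => a b.1) i))) := by
    rw [Fintype.linearIndependent_iff]
    intro γ hγ
    rw [Fintype.sum_sum_type] at hγ
    simp only [Sum.elim_inl, Sum.elim_inr] at hγ
    have hl : (fun j => γ (Sum.inl j)) = 0 := by
      refine Matrix.eq_zero_of_mulVec_eq_zero (M := M.map (Int.cast : ℤ → ℝ)) ?_ ?_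
      · have : (M.map (Int.cast : ℤ → ℝ)).det = ((M.det : ℤ) : ℝ) :=
          (RingHom.map_det (Int.castRingHom ℝ) M).symm
        rw [this]
        exact_mod_cast hdet
      · ext i
        have h := congrArg (fun v => v ⬝ᵥ toReal (x (c i))) hγ
        simp only [add_dotProduct, sum_dotProduct, smul_dotProduct, toReal_dotProduct, hx,
          zero_dotProduct] at h
        rw [Finset.sum_eq_zero (s := (Finset.univ : Finset {b : κ // b ∉ Set.range c})), add_zero] at h
        · simp only [Matrix.mulVec, dotProduct, Matrix.map_apply, hMij, Pi.zero_apply]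
          rw [← h]
          exact Finset.sum_congr rfl fun j _ => mul_comm _ _
        · intro b _
          have : b.1 ≠ c i := fun h => b.2 ⟨i, h.symm⟩
          simp [this]
    have hr : ∀ b : {b : κ // b ∉ Set.range c}, γ (Sum.inr b) = 0 := by
      have h1 := hind.comp (Subtype.val : {b : κ // b ∉ Set.range c} → κ) Subtype.val_injective
      rw [Fintype.linearIndependent_iff] at h1
      apply h1
      rw [← hγ]
      simp [fun j => congrFun hl j]
    rintro (j | b)
    · exact congrFun hl j
    · exact hr b
  have hz : ∀ i₀ : Fin k, ∃ z : Fin g → ℤ,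
      (∀ j, A.col (s j) ⬝ᵥ z = if i₀ = j then 1 else 0) ∧
        ∀ b : κ, b ∉ Set.range c → A.col (a b) ⬝ᵥ z = 0 := by
    intro i₀
    obtain ⟨z, hz⟩ := hA _ _ hli (Sum.elim (fun j => if i₀ = j then 1 else 0) 0)
    exact ⟨z, fun j => hz (Sum.inl j), fun b hb => hz (Sum.inr ⟨b, hb⟩)⟩
  choose z hz1 hz2 using hz
  -- By `hexp`, the vectors z dual to the exchanged basis give an integer left inverse of M, so det
  -- M = ±1.
  let Z : Matrix (Fin k) (Fin k) ℤ := Matrix.of fun i₀ i => A.col (a (c i)) ⬝ᵥ z i₀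
  have hZM : Z * M = 1 := by
    ext i₀ j
    rw [Matrix.one_apply, ← hz1, hexp, Matrix.mul_apply]
    refine Fintype.sum_of_injective c hcinj _ _ ?_ ?_
    · intro b hb
      rw [hz2 _ _ hb, mul_zero]
    · intro i
      rw [hMij, mul_comm]; rfl
  have hunit : IsUnit M.det := by
    have := congrArg Matrix.det hZM
    rw [Matrix.det_mul, Matrix.det_one] at this
    exact IsUnit.of_mul_eq_one_right _ this
  rcases Int.isUnit_iff.1 hunit with h | h
  · exact ⟨1, by simp [h]⟩
  · exact ⟨-1, by simp [h]⟩

end Unimodular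

/-! ### Integer solutions from Delone cells -/

section Intersection

variable {g n : ℕ}

lemma exists_value_eq_sum_of_mem_matroidalCone {A : Matrix (Fin g) (Fin n) ℤ}
    {Q : Matrix (Fin g) (Fin g) ℝ} (hQ : Q ∈ matroidalCone A) :
    ∃ l : Fin n → ℝ, (∀ j, 0 ≤ l j) ∧
      ∀ x, value Q x = ∑ j, l j * (toReal (A.col j) ⬝ᵥ x) ^ 2 := by
  obtain ⟨l, rfl⟩ := (Submodule.mem_span_range_iff_exists_fun _).1 hQ
  refine ⟨fun j => l j, fun j => (l j).2, fun x => ?_⟩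
  simp only [← value_rankOne]
  simp only [value, Matrix.sum_mulVec, dotProduct_sum]
  refine Finset.sum_congr rfl fun j _ => ?_
  rw [show l j • rankOne (A.col j) = (l j : ℝ) • rankOne (A.col j) from rfl, Matrix.smul_mulVec,
    dotProduct_smul, smul_eq_mul]

/-- Clearing denominators in the rational spanning set of the null space. -/
lemma mem_span_intKernel {Q : Matrix (Fin g) (Fin g) ℝ} (hQ : Q ∈ rationalForms g)
    {w : Fin g → ℝ} (hw : value Q w = 0) :
    w ∈ Submodule.span ℝ (toReal '' {z : Fin g → ℤ | value Q (toReal z) = 0}) := by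
  obtain ⟨hpsd, S, hS⟩ := hQ
  have hw' : w ∈ LinearMap.ker Q.mulVecLin := by
    rw [LinearMap.mem_ker, Matrix.mulVecLin_apply]
    refine (hpsd.dotProduct_mulVec_zero_iff w).1 ?_
    simpa [value] using hw
  have hSker : ∀ v ∈ S, Q *ᵥ (fun i => (v i : ℝ)) = 0 := by
    intro v hv
    have : (fun i => (v i : ℝ)) ∈ LinearMap.ker Q.mulVecLin := by
      rw [← hS]; exact Submodule.subset_span ⟨v, hv, rfl⟩
    simpa using this
  rw [← hS] at hw'
  refine Submodule.span_le.2 ?_ hw'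
  rintro _ ⟨v, hv, rfl⟩
  obtain ⟨d, hd⟩ := IsLocalization.exist_integer_multiples_of_finite (nonZeroDivisors ℤ) v
  choose z hz using hd
  have hd0 : ((d : ℤ) : ℝ) ≠ 0 := by
    exact_mod_cast nonZeroDivisors.coe_ne_zero d
  have hzv : toReal z = ((d : ℤ) : ℝ) • fun i => (v i : ℝ) := by
    ext i
    have := hz i
    simp only [toReal, Pi.smul_apply, smul_eq_mul]
    have h2 : ((z i : ℤ) : ℚ) = ((d : ℤ) : ℚ) * v i := by simpa [zsmul_eq_mul] using this
    exact_mod_cast congrArg (Rat.cast : ℚ → ℝ) h2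
  have : (fun i => (v i : ℝ)) = ((d : ℤ) : ℝ)⁻¹ • toReal z := by
    rw [hzv, smul_smul, inv_mul_cancel₀ hd0, one_smul]
  simp only [this]
  refine Submodule.smul_mem _ _ (Submodule.subset_span ⟨z, ?_, rfl⟩)
  simp only [Set.mem_ofPred_eq]
  rw [hzv, value_smul]
  simp [value, hSker v hv]

/-- If a secondary cone is generated by the forms `ξ ξᵗ`, for `ξ` a primitive column of `A`, then
integer equations along linearly independent columns of `A` have integer solutions. -/
lemma exists_dotProduct_eq_of_secondaryCone_eq {A : Matrix (Fin g) (Fin n) ℤ}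
    (hprim : ∀ j, ∃ u : Fin g → ℤ, A.col j ⬝ᵥ u = 1) {Q : Matrix (Fin g) (Fin g) ℝ}
    (hQ : Q ∈ rationalForms g) (hA : secondaryCone (delone Q) = matroidalCone A)
    {ι : Type} [Fintype ι] (s : ι → Fin n)
    (hs : LinearIndependent ℝ (fun i => toReal (A.col (s i)))) (m : ι → ℤ) :
    ∃ x : Fin g → ℤ, ∀ i, A.col (s i) ⬝ᵥ x = m i := by
  classical
  have hQmem : Q ∈ matroidalCone A := by
    rw [← hA]; exact subset_closure ⟨hQ, rfl⟩
  have hrank : ∀ j, rankOne (A.col j) ∈ secondaryCone (delone Q) := fun j => by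
    rw [hA]; exact Submodule.subset_span ⟨j, rfl⟩
  have hwidth : ∀ j c, ∀ p ∈ argminLattice Q c, ∀ q ∈ argminLattice Q c,
      A.col j ⬝ᵥ p - A.col j ⬝ᵥ q ≤ 1 := by
    intro j c p hp q hq
    obtain ⟨P, hP, hPmem⟩ := exists_cell_of_argminLattice Q c ⟨p, hp⟩
    obtain ⟨u, hu⟩ := hprim j
    exact dotProduct_sub_dotProduct_le_one hP (hrank j) hu (hPmem p hp) (hPmem q hq)
  obtain ⟨l, hl0, hl⟩ := exists_value_eq_sum_of_mem_matroidalCone hQmem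
  -- only the columns with positive coefficient matter
  have hl' : ∀ x, value Q x =
      ∑ j : {j // 0 < l j}, l j * (toReal (A.col j) ⬝ᵥ x) ^ 2 := by
    intro x
    rw [hl]
    symm
    refine Fintype.sum_of_injective Subtype.val Subtype.val_injective _ _ ?_ fun _ => rfl
    intro j hj
    have : l j = 0 := by
      by_contra h
      exact hj ⟨⟨j, lt_of_le_of_ne (hl0 j) (Ne.symm h)⟩, rfl⟩
    rw [this, zero_mul]
  have hzero : ∀ x, value Q x = 0 ↔ ∀ j : {j // 0 < l j}, toReal (A.col j) ⬝ᵥ x = 0 := by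
    intro x
    rw [hl', Finset.sum_eq_zero_iff_of_nonneg fun j _ => mul_nonneg (hl0 _) (sq_nonneg _)]
    simp only [Finset.mem_univ, true_implies, mul_eq_zero, sq_eq_zero_iff]
    exact forall_congr' fun j => or_iff_right j.2.ne'
  have hcover : ∀ y, ∃ c, ∃ p ∈ convexHull ℝ (toReal '' argminLattice Q c),
      value Q (y - p) = 0 := by
    intro y
    obtain ⟨c, p, hp, h⟩ := exists_mem_convexHull_argminLattice
      (l := fun j : {j // 0 < l j} => l j) (fun j => j.2) (fun j => A.col j) hl'
      (fun w hw => by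
        have := mem_span_intKernel hQ ((hzero w).2 hw)
        simp only [hzero, toReal_dotProduct, Int.cast_eq_zero] at this
        exact this) y
    refine ⟨c, p, hp, (hzero _).2 fun j => ?_⟩
    rw [dotProduct_sub, h, sub_self]
  -- This covers also the columns with coefficient zero in Q. All multiples of an integer null
  -- vector z minimize Q, so they lie in one cell, and the width bound forces the column to vanish
  -- on z.
  have hcolker : ∀ j w, value Q w = 0 → toReal (A.col j) ⬝ᵥ w = 0 := by
    intro j w hw
    refine Submodule.span_induction (p := fun w _ => toReal (A.col j) ⬝ᵥ w = 0) ?_ ?_ ?_ ?_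
      (mem_span_intKernel hQ hw)
    · rintro _ ⟨z, hz, rfl⟩
      have hz' : value Q (toReal z) = 0 := hz
      have harg : ∀ k : ℤ, k • z ∈ argminLattice Q 0 := by
        intro k y
        rw [toReal_smul, value_smul, hz']
        simpa using value_nonneg hQ.1 _
      rw [toReal_dotProduct]
      refine eq_zero_of_forall_intCast_mul_le (B := 1) fun k => ?_
      have := hwidth j 0 _ (harg k) _ (harg 0)
      simp only [dotProduct_smul, zero_smul, dotProduct_zero, sub_zero, smul_eq_mul] at this
      exact_mod_cast this
    · exact dotProduct_zero _
    · intro x y _ _ hx hy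
      rw [dotProduct_add, hx, hy, add_zero]
    · intro a x _ hx
      rw [dotProduct_smul, hx, smul_zero]
  obtain ⟨y, hy⟩ : ∃ y : Fin g → ℝ, ∀ i, toReal (A.col (s i)) ⬝ᵥ y = m i := by
    let B : Matrix ι (Fin g) ℝ := Matrix.of fun i => toReal (A.col (s i))
    have hB : Function.Surjective B.mulVecLin := by
      have hr : B.rank = Fintype.card ι := LinearIndependent.rank_matrix (M := B) hs
      rw [← LinearMap.range_eq_top]
      refine Submodule.eq_top_of_finrank_eq ?_
      rw [Module.finrank_pi, ← hr]
      rfl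
    obtain ⟨y, hy⟩ := hB fun i => m i
    exact ⟨y, fun i => congrFun hy i⟩
  obtain ⟨c, p, hp, hpy⟩ := hcover y
  have hpm : ∀ i, toReal (A.col (s i)) ⬝ᵥ p = m i := by
    intro i
    have := hcolker (s i) _ hpy
    rw [dotProduct_sub, hy] at this
    linarith
  obtain ⟨κ, _, w, z, hw0, hw1, hz, hzp⟩ := mem_convexHull_iff_exists_fintype.1 hp
  choose x hx hxz using hz
  have hsum : ∀ i, ∑ k, w k * (((A.col (s i) ⬝ᵥ x k - m i : ℤ)) : ℝ) = 0 := by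
    intro i
    have h1 := hpm i
    rw [← hzp, dotProduct_sum] at h1
    simp only [dotProduct_smul, ← hxz, toReal_dotProduct, smul_eq_mul] at h1
    push_cast
    simp only [mul_sub, Finset.sum_sub_distrib, h1, ← Finset.sum_mul, hw1]
    ring
  obtain ⟨k₀, hk₀⟩ : ∃ k, 0 < w k := by
    by_contra! h
    have : ∑ k, w k ≤ 0 := Finset.sum_nonpos fun k _ => h k
    linarith
  refine ⟨x k₀, fun i => ?_⟩
  -- all the values differ by at most one, and their mean is an integer
  by_contra hne
  rcases lt_or_gt_of_ne hne with hlt | hgt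
  · have hle : ∀ k, w k * (((A.col (s i) ⬝ᵥ x k - m i : ℤ)) : ℝ) ≤ 0 := by
      intro k
      refine mul_nonpos_of_nonneg_of_nonpos (hw0 k) ?_
      have := hwidth (s i) c _ (hx k) _ (hx k₀)
      exact_mod_cast (by omega : A.col (s i) ⬝ᵥ x k - m i ≤ 0)
    have h := (Finset.sum_eq_zero_iff_of_nonpos fun k _ => hle k).1 (hsum i) k₀ (Finset.mem_univ _)
    rcases mul_eq_zero.1 h with h | h
    · exact hk₀.ne' h
    · have : A.col (s i) ⬝ᵥ x k₀ - m i = 0 := by exact_mod_cast h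
      omega
  · have hge : ∀ k, 0 ≤ w k * (((A.col (s i) ⬝ᵥ x k - m i : ℤ)) : ℝ) := by
      intro k
      refine mul_nonneg (hw0 k) ?_
      have := hwidth (s i) c _ (hx k₀) _ (hx k)
      exact_mod_cast (by omega : 0 ≤ A.col (s i) ⬝ᵥ x k - m i)
    have h := (Finset.sum_eq_zero_iff_of_nonneg fun k _ => hge k).1 (hsum i) k₀ (Finset.mem_univ _)
    rcases mul_eq_zero.1 h with h | h
    · exact hk₀.ne' h
    · have : A.col (s i) ⬝ᵥ x k₀ - m i = 0 := by exact_mod_cast h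
      omega

end Intersection

end QuadCone

theorem proposition4p3p1 (g : ℕ) :
    QuadCone.secondVoronoiDecomposition g ∩ QuadCone.perfectConeDecomposition g ⊆
      QuadCone.matroidalDecomposition g := by
  rintro σ ⟨⟨_, ⟨Q₀, hQ₀, rfl⟩, hσ⟩, Q, hQ, rfl⟩
  obtain ⟨n, A, hsimple, hmin, hcone⟩ := QuadCone.exists_simple_matrix hQ
  refine ⟨n, A, ?_, hsimple, hcone⟩
  refine QuadCone.isUnimodular_of_forall_exists_dotProduct_eq A fun ι _ s hs m => ?_
  exact QuadCone.exists_dotProduct_eq_of_secondaryCone_eq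
    (fun j => QuadCone.minimalVectors_exists_dotProduct_eq_one hQ (hmin j)) hQ₀
    (hσ.symm.trans hcone) s hs m
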